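/- Call a site of $\mathbb Z^2$ open with probability $p$, independently of all other sites, and let $p_c$ be the threshold for oriented site percolation on $\mathbb Z^2$, i.e. the supremum of all $p\in[0,1]$ such that almost surely there is no infinite path of open sites which starts at the origin and all of whose steps are of the form $v\to v+(1,0)$ or $v\to v+(0,1)$. Then $p_c<1$, and there is a real number $$\lambda_c\in\left[-\tfrac12\ln(1-p_c),\,-\tfrac32\ln(1-p_c)\right]$$ with the following property. Let $K>0$, $\lambda>0$, and let $(\mathcal Y_x)_{x\in\mathbb Z}$ be independent homogeneous Poisson point processes on $\mathbb R$, each of intensity $\lambda$, defined on a probability space $(\Omega,\mathcal F,P)$ and regarded as random closed subsets of $\mathbb R$. Let $L_K$ be the event that there is a function $f:\mathbb R\to\mathbb R$ which is Lipschitz continuous with Lipschitz constant $K$ and satisfies $f(x)\in\mathcal Y_x$ for all $x\in\mathbb Z$. Then $L_K$ belongs to the $P$-completion of $\mathcal F$, and $$P[L_K]=0\ \text{ if }\ \lambda<\lambda_c/K,\qquad P[L_K]=1\ \text{ if }\ \lambda>\lambda_c/K .$$ -/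

import Mathlib

open MeasureTheory ProbabilityTheory TopologicalSpace
open scoped NNReal unitInterval

namespace InterpolationPercolation

noncomputable section

/-! ### Oriented site percolation on the square lattice -/

/-- There is an infinite path of open sites which starts at the origin and each of whose steps
goes along one of the directed edges `v → v + (1, 0)` and `v → v + (0, 1)`. -/
def PercolatesFromOrigin (openSites : Set (ℤ × ℤ)) : Prop :=
  ∃ γ : ℕ → ℤ × ℤ, γ 0 = (0, 0) ∧
    (∀ n, γ (n + 1) = γ n + (1, 0) ∨ γ (n + 1) = γ n + (0, 1)) ∧
    ∀ n, γ n ∈ openSites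

/-- The percolation probability when the sites are open independently with probability `p`. -/
def percolationProb (p : I) : ENNReal :=
  setBernoulli (Set.univ : Set (ℤ × ℤ)) p {s | PercolatesFromOrigin s}

/-- The threshold for oriented site percolation on `ℤ²`. -/
def orientedThreshold : ℝ :=
  sSup ((fun p : I => (p : ℝ)) '' {p : I | percolationProb p = 0})

/-! ### Random closed sets and Poisson point processes on the line -/

/-- The Borel σ-algebra of the Fell topology on the closed subsets of `ℝ`: it is generated by the
families `{F | F ∩ C ≠ ∅}` with `C` compact. -/
@[reducible] def fellBorel : MeasurableSpace (Closeds ℝ) :=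
  MeasurableSpace.generateFrom
    {A | ∃ C : Set ℝ, IsCompact C ∧ A = {F : Closeds ℝ | ((F : Set ℝ) ∩ C).Nonempty}}

variable {Ω : Type*} [MeasurableSpace Ω]

/-- A random closed subset of `ℝ`. -/
def IsRandomClosedSet (Y : Ω → Closeds ℝ) : Prop :=
  Measurable[_, fellBorel] Y

/-- `Y`, a random closed set, is a homogeneous Poisson point process on `ℝ` with intensity `lam`:
the number of its points in a bounded Borel set `B` has the Poisson distribution with
parameter `lam * |B|`, and the numbers of its points in finitely many pairwise disjoint bounded
Borel sets are independent. -/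
structure IsPoissonPointProcess (lam : ℝ≥0) (Y : Ω → Closeds ℝ) (P : Measure Ω) : Prop where
  isRandomClosedSet : IsRandomClosedSet Y
  hasLaw_count : ∀ B : Set ℝ, MeasurableSet B → Bornology.IsBounded B →
    HasLaw (fun ω => ((Y ω : Set ℝ) ∩ B).encard)
      ((poissonMeasure (lam * (volume B).toNNReal)).map (fun n : ℕ => (n : ℕ∞))) P
  indep_count : ∀ (n : ℕ) (B : Fin n → Set ℝ), (∀ i, MeasurableSet (B i)) →
    (∀ i, Bornology.IsBounded (B i)) → Pairwise (Function.onFun Disjoint B) →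
    iIndepFun (fun i ω => ((Y ω : Set ℝ) ∩ B i).encard) P

/-- `(Y x)`, `x ∈ ℤ`, are independent homogeneous Poisson point processes on `ℝ`, all of the same
intensity `lam`. -/
structure IsIndepPoissonFamily (lam : ℝ≥0) (Y : ℤ → Ω → Closeds ℝ) (P : Measure Ω) : Prop where
  poisson : ∀ x, IsPoissonPointProcess lam (Y x) P
  indep : iIndepFun (m := fun _ : ℤ => fellBorel) Y P

/-! ### Interpolating functions -/

/-- The set of all functions `f : ℝ → ℝ` with `f x ∈ Y x` for all `x ∈ ℤ`. -/
def interpolants (Y : ℤ → Closeds ℝ) : Set (ℝ → ℝ) :=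
  {f | ∀ x : ℤ, f (x : ℝ) ∈ Y x}

/-- The event that there is an interpolating function which is Lipschitz continuous with Lipschitz
constant `K`. -/
def lipschitzEvent (Y : ℤ → Ω → Closeds ℝ) (K : ℝ≥0) : Set Ω :=
  {ω | ∃ f ∈ interpolants (fun x => Y x ω), LipschitzWith K f}

end

end InterpolationPercolation

open InterpolationPercolation

namespace InterpolationPercolation

open scoped Pointwise

/-! ### Laws of random sets of sites -/

section BernoulliSets

variable {ι : Type*}

/-! Only the values at integers matter: an interpolant exists iff points of the fibres can be chosen
with successive increments at most `K` (`mem_interpolable_iff_exists_lipschitzWith`). This event is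
shift invariant, so it has probability 0 or 1. Dilating the line shows that its probability depends
only on the product of intensity and `K`, monotonically (`HasPoissonVoids.interpolable_le`). The
critical value is therefore an infimum of products, and only its bounds need work.

Both bounds come from percolation. The site `v` gets an interval of length `2h` in fibre `v.1 +
v.2`, centred at `h (v.1 - v.2)` up to an offset, and is open if the interval is hit. Intervals in
one fibre overlap at most in endpoints, so sites are open independently with probability `1 - exp
(-2hλ)` (`HasPoissonVoids.map_hitSites`). With `h = K`, every admissible sequence follows an open
oriented path from one of countably many starting intervals, so subcriticality forces probability 0.
With `h = K / 3`, any points chosen along an open path have increments at most `K`; independent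
forward and backward paths, glued at the origin, give positive probability, hence 1.

That the threshold is below 1 is a Peierls estimate. Measurability is compactness. Of the Poisson
property only the void probabilities are used, since they determine the law of a random closed set.
-/

/-- The sets which avoid the finite set `T`. -/
def avoiding (T : Finset ι) : Set (Set ι) := {s | ∀ v ∈ T, v ∉ s}

lemma measurableSet_avoiding (T : Finset ι) : MeasurableSet (avoiding T) := by
  have : avoiding T = ⋂ v ∈ T, {s : Set ι | v ∈ s}ᶜ := by
    ext s; simp [avoiding]
  rw [this]
  exact Finset.measurableSet_biInter _ fun v _ =>
    (measurableSet_setOfPred.2 (measurable_set_mem v)).compl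

/-- The complements of the coordinate events are avoidance events of singletons. Together with the
π-system property, this makes avoidance probabilities determine the law of a random set. -/
lemma generateFrom_avoiding :
    (inferInstance : MeasurableSpace (Set ι)) =
      MeasurableSpace.generateFrom (Set.range (avoiding (ι := ι))) := by
  apply le_antisymm
  · have h : Measurable[MeasurableSpace.generateFrom (Set.range (avoiding (ι := ι))), _]
        (id : Set ι → Set ι) := by
      refine (@measurable_set_iff ι (Set ι)
        (MeasurableSpace.generateFrom (Set.range (avoiding (ι := ι)))) id).2 fun v => ?_
      refine (@measurableSet_setOfPred _ (MeasurableSpace.generateFrom _) _).1 ?_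
      have : {s : Set ι | v ∈ id s} = (avoiding {v})ᶜ := by
        ext s; simp [avoiding]
      rw [this]
      exact MeasurableSet.compl (MeasurableSpace.measurableSet_generateFrom (Set.mem_range_self {v}))
    exact fun s hs => h hs
  · refine MeasurableSpace.generateFrom_le ?_
    rintro _ ⟨T, rfl⟩
    exact measurableSet_avoiding T

lemma isPiSystem_avoiding : IsPiSystem (Set.range (avoiding (ι := ι))) := by
  classical
  rintro _ ⟨S, rfl⟩ _ ⟨T, rfl⟩ -
  refine ⟨S ∪ T, ?_⟩
  ext s
  simp only [avoiding, Set.mem_ofPred_eq, Finset.mem_union, Set.mem_inter_iff]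
  exact ⟨fun h => ⟨fun v hv => h v (.inl hv), fun v hv => h v (.inr hv)⟩,
    fun h v hv => hv.elim (h.1 v) (h.2 v)⟩

lemma setBernoulli_avoiding (p : I) (T : Finset ι) :
    setBernoulli (Set.univ : Set ι) p (avoiding T) = ENNReal.ofReal (1 - p) ^ T.card := by
  rw [setBernoulli_apply']
  have : (fun p : ι → Prop => {i | p i}) ⁻¹' avoiding T = (T : Set ι).pi fun _ => {False} := by
    ext q; simp [avoiding, Set.mem_pi]
  rw [this, Measure.infinitePi_pi _ fun _ _ => MeasurableSet.of_discrete]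
  have h1 : ((unitInterval.toNNReal (unitInterval.symm p) : ℝ≥0) : ENNReal)
      = ENNReal.ofReal (1 - p) := by
    rw [← ENNReal.ofReal_coe_nnreal]; simp
  have h2 : (unitInterval.toNNReal p • Measure.dirac True +
      unitInterval.toNNReal (unitInterval.symm p) • Measure.dirac False) ({False} : Set Prop) =
      ENNReal.ofReal (1 - p) := by
    rw [Measure.add_apply, Measure.smul_apply, Measure.smul_apply,
      Measure.dirac_apply' _ .of_discrete, Measure.dirac_apply' _ .of_discrete, ← h1]
    simp [ENNReal.smul_def]
  simp only [Set.mem_univ]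
  rw [Finset.prod_congr rfl fun _ _ => h2, Finset.prod_const]

/-- A random set which avoids finite sets with the right probabilities is a Bernoulli set. -/
lemma map_eq_setBernoulli {Ω : Type*} [MeasurableSpace Ω] (P : Measure Ω) [IsProbabilityMeasure P]
    (X : Ω → Set ι) (hX : ∀ v, MeasurableSet {ω | v ∈ X ω}) (p : I)
    (h : ∀ T : Finset ι, P {ω | ∀ v ∈ T, v ∉ X ω} = ENNReal.ofReal (1 - p) ^ T.card) :
    P.map X = setBernoulli Set.univ p := by
  have hm : Measurable X := measurable_set_iff.2 fun v => measurableSet_setOfPred.1 (hX v)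
  have := Measure.isProbabilityMeasure_map (μ := P) hm.aemeasurable
  refine ext_of_generate_finite _ generateFrom_avoiding isPiSystem_avoiding ?_ (by simp)
  rintro _ ⟨T, rfl⟩
  rw [Measure.map_apply hm (measurableSet_avoiding T), setBernoulli_avoiding]
  exact h T

/-- The coupling of Bernoulli sets of all densities by independent uniform variables. -/
lemma map_uniform_eq_setBernoulli (p : I) :
    (Measure.infinitePi fun _ : ι => (volume : Measure I)).map (fun U => {v | U v ≤ p}) =
      setBernoulli Set.univ p := by
  refine map_eq_setBernoulli _ _ (fun v => ?_) p fun T => ?_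
  · exact measurableSet_le (measurable_pi_apply v) measurable_const
  · have : {U : ι → I | ∀ v ∈ T, v ∉ {v | U v ≤ p}} = (T : Set ι).pi fun _ => Set.Ioi p := by
      ext U; simp [Set.mem_pi]
    rw [this, Measure.infinitePi_pi _ fun _ _ => measurableSet_Ioi]
    simp [unitInterval.volume_Ioi]

end BernoulliSets

/-! ### Paths coded by binary sequences -/

section Branches

/-- Kőnig's lemma, for conditions on binary sequences. -/
lemma exists_branch_iff (A : ℕ → (ℕ → Bool) → Prop)
    (hA : ∀ n ξ τ, (∀ i < n, ξ i = τ i) → A n ξ → A n τ) :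
    (∃ ξ, ∀ n, A n ξ) ↔
      ∀ N, ∃ w : Fin N → Bool, ∀ n ≤ N, A n fun i => if h : i < N then w ⟨i, h⟩ else false := by
  constructor
  · rintro ⟨ξ, hξ⟩ N
    refine ⟨fun i => ξ i, fun n hn => hA n ξ _ (fun i hi => ?_) (hξ n)⟩
    simp [hi.trans_le hn]
  · intro h
    -- Each condition reads finitely many coordinates, so these are nested nonempty closed sets in
    -- the compact Cantor space.
    have key : (⋂ N, {ξ : ℕ → Bool | ∀ n ≤ N, A n ξ}).Nonempty := by
      have hcl : ∀ N, IsClosed {ξ : ℕ → Bool | ∀ n ≤ N, A n ξ} := by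
        intro N
        have : {ξ : ℕ → Bool | ∀ n ≤ N, A n ξ} = ⋂ n ∈ Set.Iic N, {ξ | A n ξ} := by
          ext; simp
        rw [this]
        refine isClosed_biInter fun n _ => ?_
        have : {ξ : ℕ → Bool | A n ξ} = (fun ξ (i : Fin n) => ξ i) ⁻¹'
            {w | A n fun i => if h : i < n then w ⟨i, h⟩ else false} := by
          ext ξ
          refine ⟨hA n _ _ fun i hi => ?_, hA n _ _ fun i hi => ?_⟩ <;> simp [hi]
        rw [this]
        exact (isClosed_discrete _).preimage (by fun_prop)
      refine IsCompact.nonempty_iInter_of_sequence_nonempty_isCompact_isClosed _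
        (fun N ξ hξ n hn => hξ n (hn.trans N.le_succ)) (fun N => ?_) (hcl 0).isCompact hcl
      obtain ⟨w, hw⟩ := h N
      exact ⟨_, hw⟩
    obtain ⟨ξ, hξ⟩ := key
    exact ⟨ξ, fun n => Set.mem_iInter.1 hξ n n le_rfl⟩

/-- Kőnig's lemma trades the uncountable union over branches for countable operations over finite
words. -/
lemma measurableSet_exists_branch {X : Type*} [MeasurableSpace X] (A : ℕ → (ℕ → Bool) → Set X)
    (hA : ∀ n ξ τ, (∀ i < n, ξ i = τ i) → A n ξ = A n τ) (hm : ∀ n ξ, MeasurableSet (A n ξ)) :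
    MeasurableSet {x | ∃ ξ, ∀ n, x ∈ A n ξ} := by
  have : {x | ∃ ξ, ∀ n, x ∈ A n ξ} = ⋂ N, ⋃ w : Fin N → Bool, ⋂ n ∈ Set.Iic N,
      A n fun i => if h : i < N then w ⟨i, h⟩ else false := by
    ext x
    simp only [Set.mem_ofPred_eq, Set.mem_iInter, Set.mem_iUnion, Set.mem_Iic]
    exact exists_branch_iff (fun n ξ => x ∈ A n ξ) fun n ξ τ h hx => hA n ξ τ h ▸ hx
  rw [this]
  exact MeasurableSet.iInter fun N => MeasurableSet.iUnion fun w =>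
    MeasurableSet.biInter (Set.to_countable _) fun n _ => hm n _

/-- The oriented path from the origin coded by `ξ`. -/
def orientedPath (ξ : ℕ → Bool) : ℕ → ℤ × ℤ
  | 0 => (0, 0)
  | n + 1 => orientedPath ξ n + if ξ n then (1, 0) else (0, 1)

lemma orientedPath_congr {ξ τ : ℕ → Bool} (n : ℕ) (h : ∀ i < n, ξ i = τ i) :
    orientedPath ξ n = orientedPath τ n := by
  induction n with
  | zero => rfl
  | succ n ih =>
    rw [orientedPath, orientedPath, ih fun i hi => h i (hi.trans n.lt_succ_self),
      h n n.lt_succ_self]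

lemma orientedPath_add (ξ : ℕ → Bool) (n : ℕ) :
    (orientedPath ξ n).1 + (orientedPath ξ n).2 = n := by
  induction n with
  | zero => rfl
  | succ n ih =>
    rw [orientedPath]
    split_ifs <;> simp <;> omega

lemma percolatesFromOrigin_iff (s : Set (ℤ × ℤ)) :
    PercolatesFromOrigin s ↔ ∃ ξ, ∀ n, orientedPath ξ n ∈ s := by
  constructor
  · rintro ⟨γ, h0, hstep, hs⟩
    classical
    refine ⟨fun n => decide (γ (n + 1) = γ n + (1, 0)), fun n => ?_⟩
    convert hs n
    induction n with
    | zero => exact h0.symm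
    | succ n ih =>
      rw [orientedPath, ih]
      by_cases h : γ (n + 1) = γ n + (1, 0)
      · simp [h]
      · simp only [h, decide_false, Bool.false_eq_true, if_false]
        exact ((hstep n).resolve_left h).symm
  · rintro ⟨ξ, hξ⟩
    refine ⟨orientedPath ξ, rfl, fun n => ?_, hξ⟩
    rw [orientedPath]
    split_ifs <;> simp

lemma measurableSet_percolatesFromOrigin : MeasurableSet {s | PercolatesFromOrigin s} := by
  simp_rw [percolatesFromOrigin_iff]
  refine measurableSet_exists_branch (fun n ξ => {s | orientedPath ξ n ∈ s})
    (fun n ξ τ h => by simp only [orientedPath_congr n h]) fun n ξ =>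
    measurableSet_setOfPred.2 (measurable_set_mem _)

lemma PercolatesFromOrigin.mono {s t : Set (ℤ × ℤ)} (hst : s ⊆ t) (h : PercolatesFromOrigin s) :
    PercolatesFromOrigin t := by
  obtain ⟨γ, h0, h1, h2⟩ := h
  exact ⟨γ, h0, h1, fun n => hst (h2 n)⟩

/-- The uniform coupling realises both densities on one space, with the sparser open set inside the
denser one. -/
lemma percolationProb_mono {p q : I} (hpq : p ≤ q) : percolationProb p ≤ percolationProb q := by
  have hm : ∀ r : I, Measurable fun U : ℤ × ℤ → I => {v | U v ≤ r} := fun r =>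
    measurable_set_iff.2 fun v => measurableSet_setOfPred.1
      (measurableSet_le (measurable_pi_apply v) measurable_const)
  rw [percolationProb, percolationProb, ← map_uniform_eq_setBernoulli,
    ← map_uniform_eq_setBernoulli, Measure.map_apply (hm p) measurableSet_percolatesFromOrigin,
    Measure.map_apply (hm q) measurableSet_percolatesFromOrigin]
  exact measure_mono fun U hU => PercolatesFromOrigin.mono (fun v hv => le_trans hv hpq) hU

lemma percolationProb_eq_zero_of_lt {p : I} (hp : (p : ℝ) < orientedThreshold) :
    percolationProb p = 0 := by
  rcases Set.eq_empty_or_nonempty ((fun p : I => (p : ℝ)) '' {p : I | percolationProb p = 0})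
    with h | h
  -- Here the supremum takes its default value 0, and no density lies below it.
  · rw [orientedThreshold, h, Real.sSup_empty] at hp
    exact absurd p.2.1 hp.not_ge
  · obtain ⟨_, ⟨q, hq, rfl⟩, hpq⟩ := exists_lt_of_lt_csSup h hp
    exact le_antisymm ((percolationProb_mono (Subtype.coe_le_coe.1 hpq.le)).trans hq.le) zero_le

lemma percolationProb_pos_of_lt {p : I} (hp : orientedThreshold < p) : 0 < percolationProb p := by
  refine pos_iff_ne_zero.2 fun h => hp.not_ge (le_csSup ?_ ⟨p, h, rfl⟩)
  refine ⟨1, ?_⟩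
  rintro _ ⟨q, -, rfl⟩
  exact q.2.2

lemma orientedThreshold_nonneg : 0 ≤ orientedThreshold := by
  refine Real.sSup_nonneg ?_
  rintro _ ⟨q, -, rfl⟩
  exact q.2.1

end Branches

/-! ### A Peierls argument for oriented percolation

The face with lower left corner `(a, b)` is denoted by `(a, b)`. A walk on the faces may always go
east or south, and it may go from the south-east face of a closed site to its north-west face. -/

section Peierls

/-- The displacements of a walk on the faces. -/
def faceMove : Fin 3 → ℤ × ℤ
  | 0 => (1, 0)
  | 1 => (0, -1)
  | 2 => (-1, 1)

/-- The walk on the faces coded by `w` which starts at the south-east face of the origin. -/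
def facePath (w : ℕ → Fin 3) : ℕ → ℤ × ℤ
  | 0 => (0, -1)
  | n + 1 => facePath w n + faceMove (w n)

lemma facePath_congr {w w' : ℕ → Fin 3} (n : ℕ) (h : ∀ i < n, w i = w' i) :
    facePath w n = facePath w' n := by
  induction n with
  | zero => rfl
  | succ n ih =>
    rw [facePath, facePath, ih fun i hi => h i (hi.trans n.lt_succ_self), h n n.lt_succ_self]

/-- The first `n` steps of the walk coded by `w` cross closed sites only. -/
def IsBlocking (s : Set (ℤ × ℤ)) (w : ℕ → Fin 3) (n : ℕ) : Prop :=
  -- `F + (0, 1)` is the site whose south-east face is `F`; its north-west face is `F + (-1, 1)`.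
  ∀ k < n, w k = 2 → facePath w k + (0, 1) ∉ s

/-- The faces which are reached by a walk from the south-east face of the origin. -/
def reachedFaces (s : Set (ℤ × ℤ)) : Set (ℤ × ℤ) :=
  {F | ∃ w n, facePath w n = F ∧ IsBlocking s w n}

lemma add_faceMove_mem_reachedFaces {s : Set (ℤ × ℤ)} {F : ℤ × ℤ} (hF : F ∈ reachedFaces s)
    (d : Fin 3) (hd : d = 2 → F + (0, 1) ∉ s) : F + faceMove d ∈ reachedFaces s := by
  obtain ⟨w, n, rfl, hw⟩ := hF
  have hc : ∀ k ≤ n, facePath (Function.update w n d) k = facePath w k := fun k hk =>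
    facePath_congr k fun i hi => Function.update_of_ne (by omega) _ _
  refine ⟨Function.update w n d, n + 1, ?_, fun k hk hk2 => ?_⟩
  · rw [facePath, hc n le_rfl, Function.update_self]
  · rw [hc k (by omega)]
    rcases Nat.lt_succ_iff_lt_or_eq.1 hk with h | rfl
    · exact hw k h (by rwa [Function.update_of_ne h.ne] at hk2)
    · exact hd (by rwa [Function.update_self] at hk2)

/-- If the north-west face of the origin is not reached, then the boundary of the set of reached
faces is an infinite open path. -/
lemma percolatesFromOrigin_of_notMem_reachedFaces {s : Set (ℤ × ℤ)}
    (h : ((-1, 0) : ℤ × ℤ) ∉ reachedFaces s) : PercolatesFromOrigin s := by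
  let V := {v : ℤ × ℤ // v + (0, -1) ∈ reachedFaces s ∧ v + (-1, 0) ∉ reachedFaces s}
  have hopen : ∀ v : V, v.1 ∈ s := by
    rintro ⟨⟨a, b⟩, h1, h2⟩
    by_contra hv
    apply h2
    have := add_faceMove_mem_reachedFaces h1 2 fun _ => by simpa using hv
    simpa [faceMove] using this
  have hnext : ∀ v : V, ∃ v' : V, v'.1 = v.1 + (1, 0) ∨ v'.1 = v.1 + (0, 1) := by
    rintro ⟨⟨a, b⟩, h1, h2⟩
    -- The face `(a, b)` is north-east of the current site. If it is reached, the boundary continues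
    -- north, otherwise east; the free moves south and east keep the next site on the boundary.
    by_cases hr : ((a, b) : ℤ × ℤ) ∈ reachedFaces s
    · refine ⟨⟨(a, b + 1), by simpa using hr, fun h3 => h2 ?_⟩, .inr (by simp)⟩
      have := add_faceMove_mem_reachedFaces h3 1 (by simp)
      simpa [faceMove] using this
    · refine ⟨⟨(a + 1, b), ?_, by simpa using hr⟩, .inl (by simp)⟩
      have := add_faceMove_mem_reachedFaces h1 0 (by simp)
      simpa [faceMove, add_comm] using this
  choose next hnext using hnext
  have h0 : ((0, 0) : ℤ × ℤ) + (0, -1) ∈ reachedFaces s :=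
    ⟨fun _ => 0, 0, rfl, fun k hk => absurd hk (Nat.not_lt_zero k)⟩
  let γ : ℕ → V := fun n => next^[n] ⟨(0, 0), h0, by simpa using h⟩
  refine ⟨fun n => (γ n).1, rfl, fun n => ?_, fun n => hopen _⟩
  simp only [γ, Function.iterate_succ_apply']
  exact hnext _

/-- A reached face is reached by a walk without repetitions. -/
lemma exists_injOn_facePath {s : Set (ℤ × ℤ)} {F : ℤ × ℤ} (hF : F ∈ reachedFaces s) :
    ∃ w n, facePath w n = F ∧ IsBlocking s w n ∧ Set.InjOn (facePath w) (Set.Iic n) := by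
  classical
  have hex : ∃ n w, facePath w n = F ∧ IsBlocking s w n := by
    obtain ⟨w, n, h⟩ := hF
    exact ⟨n, w, h⟩
  obtain ⟨w, hwF, hw⟩ := Nat.find_spec hex
  set n := Nat.find hex with hn
  refine ⟨w, n, hwF, hw, ?_⟩
  -- Since `n` is minimal, no loop between times `i` and `j` can be cut out.
  have key : ∀ i j, i < j → j ≤ n → facePath w i ≠ facePath w j := by
    intro i j hij hj heq
    let w' : ℕ → Fin 3 := fun k => if k < i then w k else w (k + (j - i))
    have h1 : ∀ k ≤ i, facePath w' k = facePath w k := fun k hk =>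
      facePath_congr k fun l hl => if_pos (hl.trans_le hk)
    have h2 : ∀ m, facePath w' (i + m) = facePath w (j + m) := by
      intro m
      induction m with
      | zero => rw [add_zero, add_zero, h1 i le_rfl, heq]
      | succ m ih =>
        rw [← add_assoc, ← add_assoc, facePath, facePath, ih]
        have : w' (i + m) = w (j + m) := by
          simp only [w', if_neg (show ¬ i + m < i by omega)]
          congr 1
          omega
        rw [this]
    have hlt : n - (j - i) < n := by omega
    refine Nat.find_min hex (hn ▸ hlt) ⟨w', ?_, fun k hk hk2 => ?_⟩
    · have := h2 (n - j)
      rw [show i + (n - j) = n - (j - i) by omega, show j + (n - j) = n by omega] at this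
      rw [this, hwF]
    · rcases lt_or_ge k i with hki | hki
      · rw [h1 k hki.le]
        exact hw k (by omega) (by simpa [w', hki] using hk2)
      · obtain ⟨m, rfl⟩ := Nat.exists_eq_add_of_le hki
        rw [h2]
        refine hw _ (by omega) ?_
        have h3 : i + m + (j - i) = j + m := by omega
        simpa [w', h3] using hk2
  intro i hi j hj heq
  rcases lt_trichotomy i j with h | h | h
  · exact absurd heq (key i j h hj)
  · exact h
  · exact absurd heq.symm (key j i h hi)

lemma facePath_eq_card (w : ℕ → Fin 3) (n : ℕ) :
    ∃ c : Fin 3 → ℕ, c 2 = ((Finset.range n).filter fun k => w k = 2).card ∧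
      c 0 + c 1 + c 2 = n ∧ facePath w n = ((c 0 : ℤ) - c 2, (c 2 : ℤ) - c 1 - 1) := by
  induction n with
  | zero => exact ⟨0, by simp, rfl, by simp [facePath]⟩
  | succ n ih =>
    obtain ⟨c, h2, hn, hp⟩ := ih
    refine ⟨fun d => c d + if w n = d then 1 else 0, ?_, ?_, ?_⟩
    · rw [Finset.range_add_one, Finset.filter_insert]
      split_ifs with h
      · rw [Finset.card_insert_of_notMem (by simp), ← h2]
        simp [h]
      · rw [← h2]
        simp [h]
    · have : w n = 0 ∨ w n = 1 ∨ w n = 2 := by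
        generalize w n = d
        fin_cases d <;> simp
      rcases this with h | h | h <;> simp [h] <;> omega
    · rw [facePath, hp]
      have : w n = 0 ∨ w n = 1 ∨ w n = 2 := by
        generalize w n = d
        fin_cases d <;> simp
      rcases this with h | h | h <;> simp [h, faceMove] <;> omega

/-- A walk around the origin of length `n` crosses `(n + 2) / 3` sites. -/
lemma three_mul_card_eq {w : ℕ → Fin 3} {n : ℕ} (h : facePath w n = (-1, 0)) :
    3 * ((Finset.range n).filter fun k => w k = 2).card = n + 2 := by
  obtain ⟨c, h2, hn, hp⟩ := facePath_eq_card w n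
  -- The endpoint forces `c 0 = c 1 = c 2 - 1`, hence `n = 3 * c 2 - 2`.
  rw [h, Prod.ext_iff] at hp
  simp only at hp
  omega

/-- A walk without repetitions crosses distinct sites, `(n + 2) / 3` in number, each closed with
probability at most `r ^ 3`. -/
lemma setBernoulli_isBlocking_le {p : I} {r : ℝ} (hr : 0 ≤ r) (hp : 1 - (p : ℝ) ≤ r ^ 3)
    {w : ℕ → Fin 3} {n : ℕ} (hw : facePath w n = (-1, 0))
    (hinj : Set.InjOn (facePath w) (Set.Iic n)) :
    setBernoulli Set.univ p {s | IsBlocking s w n} ≤ ENNReal.ofReal (r ^ (n + 2)) := by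
  classical
  set T := ((Finset.range n).filter fun k => w k = 2).image fun k => facePath w k + (0, 1)
    with hT
  have hcard : T.card = ((Finset.range n).filter fun k => w k = 2).card := by
    refine Finset.card_image_of_injOn fun i hi j hj hij => ?_
    simp only [Finset.coe_filter, Finset.mem_range, Set.mem_ofPred_eq] at hi hj
    exact hinj (Set.mem_Iic.2 hi.1.le) (Set.mem_Iic.2 hj.1.le) (add_right_cancel hij)
  have hset : {s | IsBlocking s w n} = avoiding T := by
    ext s
    simp only [IsBlocking, avoiding, hT, Set.mem_ofPred_eq, Finset.mem_image, Finset.mem_filter,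
      Finset.mem_range]
    constructor
    · rintro h _ ⟨k, ⟨hk, hk2⟩, rfl⟩
      exact h k hk hk2
    · exact fun h k hk hk2 => h _ ⟨k, ⟨hk, hk2⟩, rfl⟩
  rw [hset, setBernoulli_avoiding, hcard, ← three_mul_card_eq hw, pow_mul,
    ENNReal.ofReal_pow (by positivity)]
  gcongr

/-- Union bound over the `3 ^ n` words of length `n`: with `1 - p ≤ (1 / 4) ^ 3`, the terms `3 ^ n *
(1 / 4) ^ (n + 2)` sum to `1 / 4 < 1`. -/
lemma percolationProb_pos_of_le {p : I} (hp : 63 / 64 ≤ (p : ℝ)) : 0 < percolationProb p := by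
  classical
  set μ := setBernoulli (Set.univ : Set (ℤ × ℤ)) p
  let ext : ∀ n, (Fin n → Fin 3) → ℕ → Fin 3 := fun n w k => if h : k < n then w ⟨k, h⟩ else 0
  let E : ∀ n, (Fin n → Fin 3) → Set (Set (ℤ × ℤ)) := fun n w =>
    if facePath (ext n w) n = (-1, 0) ∧ Set.InjOn (facePath (ext n w)) (Set.Iic n)
    then {s | IsBlocking s (ext n w) n} else ∅
  have hsub : {s | PercolatesFromOrigin s}ᶜ ⊆ ⋃ n, ⋃ w, E n w := by
    intro s hs
    have hr : ((-1, 0) : ℤ × ℤ) ∈ reachedFaces s := by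
      by_contra h
      exact hs (percolatesFromOrigin_of_notMem_reachedFaces h)
    obtain ⟨w, n, hF, hb, hinj⟩ := exists_injOn_facePath hr
    have hw : ∀ k < n, w k = ext n (fun i => w i) k := fun k hk => by simp [ext, hk]
    have hp' : ∀ k ≤ n, facePath w k = facePath (ext n fun i => w i) k := fun k hk =>
      facePath_congr k fun i hi => hw i (hi.trans_le hk)
    refine Set.mem_iUnion₂.2 ⟨n, fun i => w i, ?_⟩
    simp only [E]
    rw [if_pos]
    · intro k hk hk2
      rw [← hp' k hk.le]
      exact hb k hk (by rwa [hw k hk])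
    · refine ⟨by rw [← hp' n le_rfl, hF], fun i hi j hj hij => hinj hi hj ?_⟩
      rwa [hp' i hi, hp' j hj]
  have hE : ∀ n w, μ (E n w) ≤ ENNReal.ofReal ((1 / 4) ^ (n + 2)) := by
    intro n w
    simp only [E]
    split_ifs with h
    · exact setBernoulli_isBlocking_le (by norm_num) (by linarith) h.1 h.2
    · simp
  have hle : μ {s | PercolatesFromOrigin s}ᶜ ≤ ENNReal.ofReal (1 / 4) := by
    calc μ {s | PercolatesFromOrigin s}ᶜ ≤ ∑' n, μ (⋃ w, E n w) :=
          (measure_mono hsub).trans (measure_iUnion_le _)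
      _ ≤ ∑' n : ℕ, ENNReal.ofReal ((1 / 16) * (3 / 4) ^ n) := by
          refine ENNReal.tsum_le_tsum fun n => ?_
          refine (measure_iUnion_fintype_le _ _).trans ?_
          refine (Finset.sum_le_sum fun w _ => hE n w).trans ?_
          rw [Finset.sum_const, Finset.card_univ, Fintype.card_fun, Fintype.card_fin,
            Fintype.card_fin, nsmul_eq_mul, ← ENNReal.ofReal_natCast,
            ← ENNReal.ofReal_mul (by positivity)]
          refine ENNReal.ofReal_le_ofReal (le_of_eq ?_)
          rw [div_pow, div_pow, pow_add]
          push_cast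
          ring
      _ = ENNReal.ofReal (1 / 4) := by
          have hs : HasSum (fun n : ℕ => (1 / 16 : ℝ) * (3 / 4) ^ n) (1 / 4) := by
            have := (hasSum_geometric_of_lt_one (r := (3 / 4 : ℝ)) (by norm_num)
              (by norm_num)).mul_left (1 / 16)
            rwa [show (1 / 16 : ℝ) * (1 - 3 / 4)⁻¹ = 1 / 4 by norm_num] at this
          rw [← ENNReal.ofReal_tsum_of_nonneg (fun n => by positivity) hs.summable, hs.tsum_eq]
  refine pos_iff_ne_zero.2 fun h0 => ?_
  have h1 : μ {s | PercolatesFromOrigin s} + μ {s | PercolatesFromOrigin s}ᶜ = 1 := by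
    rw [measure_add_measure_compl measurableSet_percolatesFromOrigin, measure_univ]
  rw [show μ {s | PercolatesFromOrigin s} = 0 from h0, zero_add] at h1
  rw [h1, ENNReal.one_le_ofReal] at hle
  norm_num at hle

theorem orientedThreshold_lt_one : orientedThreshold < 1 := by
  have : orientedThreshold ≤ 63 / 64 := by
    refine Real.sSup_le ?_ (by norm_num)
    rintro _ ⟨q, hq, rfl⟩
    by_contra h
    exact (percolationProb_pos_of_le (not_le.1 h).le).ne' hq
  linarith

end Peierls

/-! ### A zero-one law for shift invariant events -/

section ZeroOne

/-- An event which is invariant under all shifts of an independent and identically distributed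
family indexed by `ℤ` has probability zero or one. -/
theorem infinitePi_eq_zero_or_one_of_shift_invariant {X : Type*} [MeasurableSpace X]
    (ν : Measure X) [IsProbabilityMeasure ν] {A : Set (ℤ → X)} (hA : MeasurableSet A)
    (hinv : ∀ m : ℤ, (fun (F : ℤ → X) x => F (x + m)) ⁻¹' A = A) :
    Measure.infinitePi (fun _ : ℤ => ν) A = 0 ∨ Measure.infinitePi (fun _ : ℤ => ν) A = 1 := by
  classical
  set μ := Measure.infinitePi fun _ : ℤ => ν
  have hind : iIndepFun (fun (x : ℤ) (F : ℤ → X) => F x) μ :=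
    iIndepFun_infinitePi (X := fun _ => id) fun _ => measurable_id
  -- Approximate `A` by a cylinder `B` within `ε`. A far shift of `B` is independent of `B` and, by
  -- invariance, also approximates `A`, so `A` is nearly independent of itself.
  have key : ∀ ε : ℝ, 0 < ε → |μ.real A - μ.real A * μ.real A| ≤ 4 * ε := by
    intro ε hε
    obtain ⟨B, hB, hAB⟩ := (Measure.MeasureDense.of_generateFrom_isSetAlgebra_finite μ
      isSetAlgebra_measurableCylinders generateFrom_measurableCylinders.symm).approx A hA
      (measure_ne_top _ _) ε hε
    obtain ⟨s, S, hS, rfl⟩ := (mem_measurableCylinders _).1 hB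
    obtain ⟨b, hb⟩ : ∃ b : ℤ, ∀ i ∈ s, |i| ≤ b :=
      ⟨∑ i ∈ s, |i|, fun i hi => Finset.single_le_sum (f := fun i : ℤ => |i|)
        (fun j _ => abs_nonneg j) hi⟩
    -- Since `s` lies in `[-b, b]`, this shift moves it off itself.
    set m : ℤ := 2 * b + 1
    set T : (ℤ → X) → ℤ → X := fun F x => F (x + m) with hT
    have hTm : MeasurePreserving T μ μ :=
      ⟨by fun_prop, Measure.map_infinitePi_infinitePi_of_inj (P := fun _ : ℤ => ν)
        (f := fun x : ℤ => x + m) (add_left_injective m)⟩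
    have hBm : MeasurableSet (cylinder (α := fun _ : ℤ => X) s S) :=
      MeasurableSet.of_mem_measurableCylinders hB
    set B := cylinder (α := fun _ : ℤ => X) s S with hBdef
    have hBB : μ.real (B ∩ T ⁻¹' B) = μ.real B * μ.real B := by
      have hdisj : Disjoint s (s.image (· + m)) := by
        rw [Finset.disjoint_left]
        intro i hi hi'
        obtain ⟨j, hj, rfl⟩ := Finset.mem_image.1 hi'
        have h1 := abs_le.1 (hb _ hi)
        have h2 := abs_le.1 (hb _ hj)
        simp only [m] at h1
        omega
      have hI := hind.indepFun_finset s (s.image (· + m)) hdisj fun i => measurable_pi_apply i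
      let g : ((i : s.image (· + m)) → X) → (i : s) → X := fun u i =>
        u ⟨i + m, Finset.mem_image_of_mem _ i.2⟩
      have hI' := hI.comp (φ := id) (ψ := g) measurable_id (by fun_prop)
      have := hI'.measure_inter_preimage_eq_mul S S hS hS
      have h1 : T ⁻¹' B = (g ∘ fun (F : ℤ → X) (i : s.image (· + m)) => F i) ⁻¹' S := rfl
      have h2 : B = (id ∘ fun (F : ℤ → X) (i : s) => F i) ⁻¹' S := rfl
      have h3 : μ.real (T ⁻¹' B) = μ.real B := hTm.measureReal_preimage hBm.nullMeasurableSet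
      rw [← h1, ← h2] at this
      rw [measureReal_def, this, ENNReal.toReal_mul, ← measureReal_def, ← measureReal_def, h3]
    have hABr : μ.real (symmDiff A B) ≤ ε := by
      rw [measureReal_def]
      exact ENNReal.toReal_le_of_le_ofReal hε.le hAB.le
    have hABr' : μ.real (symmDiff A (T ⁻¹' B)) ≤ ε := by
      have : symmDiff A (T ⁻¹' B) = T ⁻¹' (symmDiff A B) := by
        rw [Set.preimage_symmDiff, hT, hinv m]
      rw [this, hTm.measureReal_preimage (hA.symmDiff hBm).nullMeasurableSet]
      exact hABr
    have h1 : |μ.real A - μ.real (B ∩ T ⁻¹' B)| ≤ 2 * ε := by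
      refine (abs_measureReal_sub_le_measureReal_symmDiff hA.nullMeasurableSet
        (hBm.inter (hTm.measurable hBm)).nullMeasurableSet).trans ?_
      have hsub : symmDiff A (B ∩ T ⁻¹' B) ⊆ symmDiff A B ∪ symmDiff A (T ⁻¹' B) := by
        intro x
        simp only [Set.mem_symmDiff, Set.mem_inter_iff, Set.mem_union]
        tauto
      refine (measureReal_mono hsub).trans ((measureReal_union_le _ _).trans ?_)
      linarith
    have h2 : |μ.real A - μ.real B| ≤ ε :=
      (abs_measureReal_sub_le_measureReal_symmDiff hA.nullMeasurableSet
        hBm.nullMeasurableSet).trans hABr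
    have h3 : |μ.real A * μ.real A - μ.real B * μ.real B| ≤ 2 * ε := by
      have : μ.real A * μ.real A - μ.real B * μ.real B =
        (μ.real A - μ.real B) * (μ.real A + μ.real B) := by ring
      rw [this, abs_mul, mul_comm 2 ε]
      have h0 : |μ.real A + μ.real B| ≤ 2 := by
        rw [abs_of_nonneg (by positivity)]
        linarith [measureReal_le_one (μ := μ) (s := A), measureReal_le_one (μ := μ) (s := B)]
      gcongr
    rw [hBB] at h1
    rw [abs_le] at *
    constructor <;> linarith [h1.1, h1.2, h3.1, h3.2]
  have h0 : μ.real A - μ.real A * μ.real A = 0 := by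
    rw [← abs_nonpos_iff]
    refine le_of_forall_pos_le_add fun ε hε => ?_
    have := key (ε / 4) (by positivity)
    linarith
  have h1 : μ.real A = 0 ∨ μ.real A = 1 := by
    have : μ.real A * (1 - μ.real A) = 0 := by linarith
    rcases mul_eq_zero.1 this with h | h
    · exact .inl h
    · exact .inr (by linarith)
  rcases h1 with h | h
  · exact .inl ((measureReal_eq_zero_iff).1 h)
  · right
    rw [← ENNReal.toReal_eq_one_iff]
    exact h

end ZeroOne

/-! ### The Fell σ-algebra and void probabilities -/

section Void

attribute [local instance] fellBorel

/-- The closed sets which miss `C`. -/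
def missing (C : Set ℝ) : Set (Closeds ℝ) := {F | (F : Set ℝ) ∩ C = ∅}

lemma compl_missing (C : Set ℝ) : (missing C)ᶜ = {F : Closeds ℝ | ((F : Set ℝ) ∩ C).Nonempty} := by
  ext F
  simp [missing, Set.nonempty_iff_ne_empty]

lemma measurableSet_missing {C : Set ℝ} (hC : IsCompact C) : MeasurableSet (missing C) := by
  rw [← MeasurableSet.compl_iff, compl_missing]
  exact MeasurableSpace.measurableSet_generateFrom ⟨C, hC, rfl⟩

lemma fellBorel_eq_generateFrom_missing :
    fellBorel = MeasurableSpace.generateFrom {A | ∃ C, IsCompact C ∧ A = missing C} := by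
  apply le_antisymm
  · refine MeasurableSpace.generateFrom_le ?_
    rintro _ ⟨C, hC, rfl⟩
    rw [← compl_missing]
    exact MeasurableSet.compl (MeasurableSpace.measurableSet_generateFrom
      (show missing C ∈ {A | ∃ C, IsCompact C ∧ A = missing C} from ⟨C, hC, rfl⟩))
  · refine MeasurableSpace.generateFrom_le ?_
    rintro _ ⟨C, hC, rfl⟩
    exact measurableSet_missing hC

lemma isPiSystem_missing : IsPiSystem {A | ∃ C, IsCompact C ∧ A = missing C} := by
  rintro _ ⟨C, hC, rfl⟩ _ ⟨D, hD, rfl⟩ -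
  refine ⟨C ∪ D, hC.union hD, ?_⟩
  ext F
  simp [missing, Set.inter_union_distrib_left]

/-- The void probabilities of a measure on the closed sets are those of a homogeneous Poisson point
process of intensity `lam`. -/
def HasPoissonVoids (lam : ℝ≥0) (ν : Measure (Closeds ℝ)) : Prop :=
  ∀ C, IsCompact C → ν (missing C) = ENNReal.ofReal (Real.exp (-(lam * volume.real C)))

/-- Void probabilities determine the law of a random closed set. -/
lemma HasPoissonVoids.unique {lam : ℝ≥0} {ν ν' : Measure (Closeds ℝ)} [IsProbabilityMeasure ν]
    [IsProbabilityMeasure ν'] (h : HasPoissonVoids lam ν) (h' : HasPoissonVoids lam ν') :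
    ν = ν' := by
  refine ext_of_generate_finite _ fellBorel_eq_generateFrom_missing isPiSystem_missing ?_ (by simp)
  rintro _ ⟨C, hC, rfl⟩
  rw [h C hC, h' C hC]

/-- The closed set `r⁻¹ F`. -/
def dilate (r : ℝ) (F : Closeds ℝ) : Closeds ℝ :=
  ⟨(fun y => r * y) ⁻¹' F, F.isClosed.preimage (by fun_prop)⟩

lemma mem_dilate {r : ℝ} {F : Closeds ℝ} {y : ℝ} : y ∈ dilate r F ↔ r * y ∈ F := Iff.rfl

lemma preimage_dilate_missing (r : ℝ) (C : Set ℝ) :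
    dilate r ⁻¹' missing C = missing ((fun y => r * y) '' C) := by
  ext F
  simp only [Set.mem_preimage, missing, Set.mem_ofPred_eq, Set.eq_empty_iff_forall_notMem,
    Set.mem_inter_iff, SetLike.mem_coe, mem_dilate, Set.mem_image]
  constructor
  · rintro h _ ⟨h1, y, hy, rfl⟩
    exact h y ⟨h1, hy⟩
  · exact fun h y hy => h (r * y) ⟨hy.1, y, hy.2, rfl⟩

lemma measurable_dilate (r : ℝ) : Measurable (dilate r) := by
  have h : Measurable[_, MeasurableSpace.generateFrom {A | ∃ C, IsCompact C ∧ A = missing C}]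
      (dilate r) := by
    refine measurable_generateFrom ?_
    rintro _ ⟨C, hC, rfl⟩
    rw [preimage_dilate_missing]
    exact measurableSet_missing (hC.image (by fun_prop))
  rwa [← fellBorel_eq_generateFrom_missing] at h

lemma HasPoissonVoids.map_dilate {lam : ℝ≥0} {ν : Measure (Closeds ℝ)}
    (h : HasPoissonVoids lam ν) (r : ℝ≥0) : HasPoissonVoids (lam * r) (ν.map (dilate r)) := by
  intro C hC
  rw [Measure.map_apply (measurable_dilate r) (measurableSet_missing hC), preimage_dilate_missing,
    h _ (hC.image (by fun_prop))]
  have : volume.real ((fun y => (r : ℝ) * y) '' C) = r * volume.real C := by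
    have := Measure.addHaar_smul (volume : Measure ℝ) (r : ℝ) C
    rw [measureReal_def, show (fun y => (r : ℝ) * y) '' C = (r : ℝ) • C from rfl, this,
      ENNReal.toReal_mul]
    simp [measureReal_def]
  rw [this]
  push_cast
  ring_nf

end Void

/-! ### The event that there is a Lipschitz interpolating sequence -/

section Interpolable

attribute [local instance] fellBorel

/-- The families of closed sets through which there is a sequence whose increments are bounded
by `K`. -/
def interpolable (K : ℝ) : Set (ℤ → Closeds ℝ) :=
  {F | ∃ y : ℤ → ℝ, (∀ x, y x ∈ F x) ∧ ∀ x, |y (x + 1) - y x| ≤ K}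

lemma abs_sub_le_of_increments {y : ℤ → ℝ} {K : ℝ} (h : ∀ x, |y (x + 1) - y x| ≤ K) (a b : ℤ) :
    |y a - y b| ≤ K * |(a : ℝ) - b| := by
  have key : ∀ (n : ℕ) (x : ℤ), |y (x + n) - y x| ≤ K * n := by
    intro n x
    induction n with
    | zero => simp
    | succ n ih =>
      have h1 := h (x + n)
      have h2 : y (x + (n + 1 : ℕ)) - y x = (y (x + n + 1) - y (x + n)) + (y (x + n) - y x) := by
        push_cast
        rw [add_assoc]
        ring
      rw [h2]
      refine (abs_add_le _ _).trans ?_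
      push_cast
      linarith
  rcases le_total a b with hab | hab
  · obtain ⟨n, rfl⟩ := Int.le.dest hab
    rw [abs_sub_comm]
    convert key n a using 2
    push_cast
    rw [abs_of_nonpos] <;> simp
  · obtain ⟨n, rfl⟩ := Int.le.dest hab
    convert key n b using 2
    push_cast
    rw [abs_of_nonneg] <;> simp

lemma mem_interpolable_iff_exists_lipschitzWith {F : ℤ → Closeds ℝ} {K : ℝ≥0} :
    F ∈ interpolable K ↔ ∃ f ∈ interpolants F, LipschitzWith K f := by
  constructor
  · rintro ⟨y, hy, hK⟩
    -- The floor only turns `y` into a function on `ℝ`; the Lipschitz bound is needed on the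
    -- integers alone, and the extension theorem does the rest.
    have hL : LipschitzOnWith K (fun t : ℝ => y ⌊t⌋) (Set.range ((↑) : ℤ → ℝ)) := by
      refine LipschitzOnWith.of_dist_le_mul ?_
      rintro _ ⟨a, rfl⟩ _ ⟨b, rfl⟩
      simp only [Int.floor_intCast, Real.dist_eq]
      exact abs_sub_le_of_increments hK a b
    obtain ⟨f, hf, hfy⟩ := hL.extend_real
    refine ⟨f, fun x => ?_, hf⟩
    rw [← hfy ⟨x, rfl⟩]
    simpa using hy x
  · rintro ⟨f, hf, hK⟩
    refine ⟨fun x => f x, hf, fun x => ?_⟩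
    have := hK.dist_le_mul ((x + 1 : ℤ) : ℝ) x
    simpa [Real.dist_eq] using this

lemma interpolable_mono {K K' : ℝ} (h : K ≤ K') : interpolable K ⊆ interpolable K' := by
  rintro F ⟨y, hy, hK⟩
  exact ⟨y, hy, fun x => (hK x).trans h⟩

lemma preimage_shift_interpolable (K : ℝ) (m : ℤ) :
    (fun (F : ℤ → Closeds ℝ) x => F (x + m)) ⁻¹' interpolable K = interpolable K := by
  ext F
  constructor
  · rintro ⟨y, hy, hK⟩
    refine ⟨fun x => y (x - m), fun x => by simpa using hy (x - m), fun x => ?_⟩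
    simpa [sub_add_eq_add_sub] using hK (x - m)
  · rintro ⟨y, hy, hK⟩
    refine ⟨fun x => y (x + m), fun x => hy _, fun x => ?_⟩
    have := hK (x + m)
    rwa [add_right_comm] at this

lemma dilate_mem_interpolable_iff {F : ℤ → Closeds ℝ} {K r : ℝ} (hr : 0 < r) :
    (fun x => dilate r (F x)) ∈ interpolable K ↔ F ∈ interpolable (r * K) := by
  constructor
  · rintro ⟨y, hy, hK⟩
    refine ⟨fun x => r * y x, hy, fun x => ?_⟩
    rw [← mul_sub, abs_mul, abs_of_pos hr]
    exact mul_le_mul_of_nonneg_left (hK x) hr.le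
  · rintro ⟨y, hy, hK⟩
    refine ⟨fun x => r⁻¹ * y x, fun x => ?_, fun x => ?_⟩
    · rw [mem_dilate, mul_inv_cancel_left₀ hr.ne']
      exact hy x
    · rw [← mul_sub, abs_mul, abs_of_pos (inv_pos.2 hr), inv_mul_le_iff₀ hr]
      exact hK x

/-- The families of closed sets through which there is an approximate interpolating sequence on
`[-n, n]`, with precision `1 / (n + 1)`. -/
def approxInterpolable (K : ℝ) (R n : ℕ) : Set (ℤ → Closeds ℝ) :=
  {F | ∃ j : ℤ →₀ ℤ, (∀ i ∈ Finset.Icc (-n : ℤ) n,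
      F i ∈ (missing (Set.Icc ((j i : ℝ) / (n + 1)) ((j i + 1) / (n + 1))))ᶜ) ∧
    (∀ i ∈ Finset.Ico (-n : ℤ) n, |(j (i + 1) : ℝ) - j i| ≤ (n + 1) * K + 1) ∧
    |(j 0 : ℝ)| ≤ (n + 1) * R}

lemma measurableSet_approxInterpolable (K : ℝ) (R n : ℕ) :
    MeasurableSet (approxInterpolable K R n) := by
  -- Finitely supported grid sequences are countable, so the union preserves measurability.
  have : approxInterpolable K R n = ⋃ j : ℤ →₀ ℤ, ((⋂ i ∈ Finset.Icc (-n : ℤ) n,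
      (fun F : ℤ → Closeds ℝ => F i) ⁻¹'
        (missing (Set.Icc ((j i : ℝ) / (n + 1)) ((j i + 1) / (n + 1))))ᶜ) ∩
      {_F | (∀ i ∈ Finset.Ico (-n : ℤ) n, |(j (i + 1) : ℝ) - j i| ≤ (n + 1) * K + 1) ∧
    |(j 0 : ℝ)| ≤ (n + 1) * R}) := by
    ext F
    simp only [approxInterpolable, Set.mem_iUnion, Set.mem_inter_iff, Set.mem_iInter,
      Set.mem_preimage, Set.mem_ofPred_eq]
  rw [this]
  refine MeasurableSet.iUnion fun j => (Finset.measurableSet_biInter _ fun i _ => ?_).inter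
    (MeasurableSet.const _)
  exact measurable_pi_apply i (measurableSet_missing isCompact_Icc).compl

lemma abs_le_of_increments_on {z : ℤ → ℝ} {M : ℝ} {n : ℕ}
    (h : ∀ i ∈ Finset.Ico (-n : ℤ) n, |z (i + 1) - z i| ≤ M) :
    ∀ i ∈ Finset.Icc (-n : ℤ) n, |z i| ≤ |z 0| + M * |(i : ℝ)| := by
  have key : ∀ k : ℕ, k ≤ n → |z k| ≤ |z 0| + M * k ∧ |z (-k)| ≤ |z 0| + M * k := by
    intro k
    induction k with
    | zero => simp
    | succ k ih =>
      intro hk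
      obtain ⟨h1, h2⟩ := ih (by omega)
      have h3 := h k (by simp; omega)
      have h4 := h (-(k + 1 : ℕ)) (by simp; omega)
      rw [show (-((k + 1 : ℕ) : ℤ)) + 1 = -k by push_cast; ring] at h4
      push_cast at *
      constructor
      · have := abs_sub_abs_le_abs_sub (z (k + 1)) (z k)
        linarith
      · have := abs_sub_abs_le_abs_sub (z (-(k + 1))) (z (-k))
        rw [abs_sub_comm] at this
        rw [neg_add] at *
        linarith
  intro i hi
  rw [Finset.mem_Icc] at hi
  rcases le_total 0 i with h0 | h0
  · obtain ⟨k, rfl⟩ := Int.eq_ofNat_of_zero_le h0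
    simpa using (key k (by omega)).1
  · obtain ⟨k, hk⟩ := Int.eq_ofNat_of_zero_le (neg_nonneg.2 h0)
    obtain rfl : i = -k := by omega
    simpa using (key k (by omega)).2

/-- Round down to the grid of mesh `1 / (n + 1)`: scaled increments change by at most 1, and
choosing `R` at least `|y 0| + 1` absorbs the rounding at 0. -/
lemma interpolable_subset_approxInterpolable (K : ℝ) :
    interpolable K ⊆ ⋃ R : ℕ, ⋂ n : ℕ, approxInterpolable K R n := by
  rintro F ⟨y, hy, hK⟩
  obtain ⟨R, hR⟩ := exists_nat_ge (|y 0| + 1)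
  refine Set.mem_iUnion.2 ⟨R, Set.mem_iInter.2 fun n => ?_⟩
  have hn : (0 : ℝ) < n + 1 := by positivity
  have hfl : ∀ i, (⌊(n + 1) * y i⌋ : ℝ) ≤ (n + 1) * y i ∧
      (n + 1) * y i < ⌊(n + 1) * y i⌋ + 1 := fun i =>
    ⟨Int.floor_le _, Int.lt_floor_add_one _⟩
  let j : ℤ →₀ ℤ := Finsupp.indicator (Finset.Icc (-n : ℤ) n) fun i _ => ⌊((n : ℝ) + 1) * y i⌋
  have hj : ∀ i ∈ Finset.Icc (-n : ℤ) n, j i = ⌊((n : ℝ) + 1) * y i⌋ := fun i hi =>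
    Finsupp.indicator_of_mem hi _
  refine ⟨j, fun i hi => ?_, fun i hi => ?_, ?_⟩
  · rw [compl_missing, hj i hi]
    refine ⟨y i, hy i, ?_, ?_⟩
    · rw [div_le_iff₀ hn]
      linarith [(hfl i).1]
    · rw [le_div_iff₀ hn]
      linarith [(hfl i).2]
  · rw [Finset.mem_Ico] at hi
    rw [hj i (Finset.mem_Icc.2 (by omega)), hj (i + 1) (Finset.mem_Icc.2 (by omega))]
    have h1 := abs_le.1 (hK i)
    have h2 := mul_le_mul_of_nonneg_left h1.1 hn.le
    have h3 := mul_le_mul_of_nonneg_left h1.2 hn.le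
    rw [abs_le]
    constructor <;> linarith [hfl i, hfl (i + 1)]
  · rw [hj 0 (by simp)]
    have h1 := abs_le.1 (le_sub_iff_add_le.2 hR)
    have h2 := mul_le_mul_of_nonneg_left h1.1 hn.le
    have h3 := mul_le_mul_of_nonneg_left h1.2 hn.le
    have hn1 : (0 : ℝ) ≤ n := by positivity
    rw [abs_le]
    constructor <;> linarith [hfl 0]

/-- Points chosen in the grid cells have increments at most `K + 2 / (n + 1)`. The fixed `R`
confines them to a compact box, and a common point of the nested closed sets `D n` has increments at
most `K` in the limit. -/
lemma approxInterpolable_subset_interpolable {K : ℝ} (hK0 : 0 ≤ K) (R : ℕ) :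
    ⋂ n : ℕ, approxInterpolable K R n ⊆ interpolable K := by
  intro F hF
  rw [Set.mem_iInter] at hF
  let box : Set (ℤ → ℝ) := Set.univ.pi fun i =>
    Set.Icc (-(R + 1 + (K + 2) * |(i : ℝ)|)) (R + 1 + (K + 2) * |(i : ℝ)|)
  let D : ℕ → Set (ℤ → ℝ) := fun n => box ∩ {y | (∀ i ∈ Finset.Icc (-n : ℤ) n, y i ∈ F i) ∧
    ∀ i ∈ Finset.Ico (-n : ℤ) n, |y (i + 1) - y i| ≤ K + 2 / (n + 1)}
  have hbox : IsCompact box := isCompact_univ_pi fun i => isCompact_Icc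
  have hcl : ∀ n, IsClosed (D n) := by
    intro n
    refine hbox.isClosed.inter ?_
    have : {y : ℤ → ℝ | (∀ i ∈ Finset.Icc (-n : ℤ) n, y i ∈ F i) ∧
        ∀ i ∈ Finset.Ico (-n : ℤ) n, |y (i + 1) - y i| ≤ K + 2 / (n + 1)} =
        (⋂ i ∈ Finset.Icc (-n : ℤ) n, (fun y : ℤ → ℝ => y i) ⁻¹' (F i : Set ℝ)) ∩
        ⋂ i ∈ Finset.Ico (-n : ℤ) n, {y | |y (i + 1) - y i| ≤ K + 2 / (n + 1)} := by
      ext y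
      simp
    rw [this]
    refine (isClosed_biInter fun i _ => (F i).isClosed.preimage (continuous_apply i)).inter
      (isClosed_biInter fun i _ => isClosed_le ?_ continuous_const)
    fun_prop
  have hmono : ∀ n, D (n + 1) ⊆ D n := by
    rintro n y ⟨hy, h1, h2⟩
    refine ⟨hy, fun i hi => h1 i ?_, fun i hi => (h2 i ?_).trans ?_⟩
    · simp only [Finset.mem_Icc] at hi ⊢
      omega
    · simp only [Finset.mem_Ico] at hi ⊢
      omega
    · push_cast
      gcongr
      linarith
  have hne : ∀ n, (D n).Nonempty := by
    intro n
    obtain ⟨j, hj1, hj2, hj3⟩ := hF n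
    have hn : (0 : ℝ) < n + 1 := by positivity
    have hz : ∀ i, ∃ z : ℝ, (i ∈ Finset.Icc (-n : ℤ) n → z ∈ F i) ∧
        (j i : ℝ) ≤ z * (n + 1) ∧ z * (n + 1) ≤ j i + 1 := by
      intro i
      by_cases hi : i ∈ Finset.Icc (-n : ℤ) n
      · have := hj1 i hi
        rw [compl_missing] at this
        obtain ⟨z, hz, h1, h2⟩ := this
        exact ⟨z, fun _ => hz, (div_le_iff₀ hn).1 h1, (le_div_iff₀ hn).1 h2⟩
      · refine ⟨j i / (n + 1), fun h => absurd h hi, ?_, ?_⟩ <;>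
          rw [div_mul_cancel₀ _ hn.ne']
        linarith
    choose z hzF hz1 hz2 using hz
    have hinc : ∀ i ∈ Finset.Ico (-n : ℤ) n, |z (i + 1) - z i| ≤ K + 2 / (n + 1) := by
      intro i hi
      have h1 := abs_le.1 (hj2 i hi)
      have h2 : (K + 2 / ((n : ℝ) + 1)) = ((n + 1) * K + 2) / (n + 1) := by field_simp
      rw [h2, le_div_iff₀ hn, ← abs_of_pos hn, ← abs_mul, abs_of_pos hn, abs_le, sub_mul]
      constructor <;> linarith [hz1 i, hz2 i, hz1 (i + 1), hz2 (i + 1)]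
    have hz0 : |z 0| ≤ R + 1 := by
      have h1 := abs_le.1 hj3
      have hn1 : (0 : ℝ) ≤ n := by positivity
      rw [← mul_le_mul_iff_left₀ hn]
      nth_rw 1 [← abs_of_pos hn]
      rw [← abs_mul, abs_le]
      constructor <;> linarith [hz1 0, hz2 0]
    have hb := abs_le_of_increments_on hinc
    refine ⟨fun i => if i ∈ Finset.Icc (-n : ℤ) n then z i else 0, fun i _ => ?_, fun i hi => ?_,
      fun i hi => ?_⟩
    · refine abs_le.1 ?_
      beta_reduce
      split_ifs with hi
      · refine (hb i hi).trans (add_le_add hz0 ?_)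
        gcongr
        rw [div_le_iff₀ hn]
        have : (0 : ℝ) ≤ n := by positivity
        linarith
      · rw [abs_zero]
        positivity
    · simp only [if_pos hi]
      exact hzF i hi
    · have h1 : i ∈ Finset.Icc (-n : ℤ) n ∧ i + 1 ∈ Finset.Icc (-n : ℤ) n := by
        simp only [Finset.mem_Icc, Finset.mem_Ico] at hi ⊢
        omega
      simp only [if_pos h1.1, if_pos h1.2]
      exact hinc i hi
  obtain ⟨y, hy⟩ := IsCompact.nonempty_iInter_of_sequence_nonempty_isCompact_isClosed D hmono hne
    (hbox.of_isClosed_subset (hcl 0) Set.inter_subset_left) hcl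
  rw [Set.mem_iInter] at hy
  refine ⟨y, fun x => ?_, fun x => ?_⟩
  · refine (hy x.natAbs).2.1 x ?_
    simp only [Finset.mem_Icc]
    omega
  · have hlim : Filter.Tendsto (fun n : ℕ => K + 2 / ((n : ℝ) + 1)) Filter.atTop (nhds K) := by
      have := (tendsto_one_div_add_atTop_nhds_zero_nat (𝕜 := ℝ)).const_mul 2
      simpa [div_eq_mul_inv] using this.const_add K
    refine ge_of_tendsto hlim (Filter.eventually_atTop.2 ⟨x.natAbs + 1, fun n hn => ?_⟩)
    refine (hy n).2.2 x ?_
    simp only [Finset.mem_Ico]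
    omega

lemma measurableSet_interpolable {K : ℝ} (hK : 0 ≤ K) : MeasurableSet (interpolable K) := by
  have : interpolable K = ⋃ R : ℕ, ⋂ n : ℕ, approxInterpolable K R n :=
    (interpolable_subset_approxInterpolable K).antisymm
      (Set.iUnion_subset fun R => approxInterpolable_subset_interpolable hK R)
  rw [this]
  exact MeasurableSet.iUnion fun R => MeasurableSet.iInter fun n =>
    measurableSet_approxInterpolable K R n

lemma interpolable_eq_zero_or_one (ν : Measure (Closeds ℝ)) [IsProbabilityMeasure ν] {K : ℝ}
    (hK : 0 ≤ K) : Measure.infinitePi (fun _ : ℤ => ν) (interpolable K) = 0 ∨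
      Measure.infinitePi (fun _ : ℤ => ν) (interpolable K) = 1 :=
  infinitePi_eq_zero_or_one_of_shift_invariant ν (measurableSet_interpolable hK)
    (preimage_shift_interpolable K)

/-- The probability of interpolation depends on the intensity and on the Lipschitz constant only
through their product, and it is monotone in it. -/
lemma HasPoissonVoids.interpolable_le {lam lam' K K' : ℝ≥0} {ν ν' : Measure (Closeds ℝ)}
    [IsProbabilityMeasure ν] [IsProbabilityMeasure ν'] (h : HasPoissonVoids lam ν)
    (h' : HasPoissonVoids lam' ν') (hlam : 0 < lam) (hlam' : 0 < lam')
    (hle : lam * K ≤ lam' * K') :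
    Measure.infinitePi (fun _ : ℤ => ν) (interpolable K) ≤
      Measure.infinitePi (fun _ : ℤ => ν') (interpolable K') := by
  -- With this ratio, `dilate r` carries intensity `lam` to `lam'`, so uniqueness of the law makes
  -- `ν'` the image of `ν`.
  set r : ℝ≥0 := lam' / lam with hr
  have hr0 : 0 < r := div_pos hlam' hlam
  have hν : ν' = ν.map (dilate r) := by
    have h1 := h.map_dilate r
    rw [hr, mul_div_cancel₀ _ hlam.ne', ← hr] at h1
    have := Measure.isProbabilityMeasure_map (μ := ν) (measurable_dilate r).aemeasurable
    exact h'.unique h1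
  have hm : Measurable fun (F : ℤ → Closeds ℝ) x => dilate r (F x) :=
    measurable_pi_lambda _ fun x => (measurable_dilate r).comp (measurable_pi_apply x)
  have hmap : (Measure.infinitePi fun _ : ℤ => ν).map (fun F x => dilate r (F x)) =
      Measure.infinitePi fun _ : ℤ => ν' := by
    rw [hν]
    exact Measure.infinitePi_map_pi (fun _ : ℤ => ν) fun _ => measurable_dilate r
  rw [← hmap, Measure.map_apply hm (measurableSet_interpolable K'.coe_nonneg)]
  refine measure_mono fun F hF => ?_
  rw [Set.mem_preimage, dilate_mem_interpolable_iff (by exact_mod_cast hr0)]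
  refine interpolable_mono ?_ hF
  have : K ≤ r * K' := by
    rw [hr, div_mul_eq_mul_div, le_div_iff₀ hlam, mul_comm]
    exact hle
  exact_mod_cast this

end Interpolable

/-! ### Comparison with oriented percolation -/

section Comparison

attribute [local instance] fellBorel

/-- The interval of length `2 h` which belongs to the site `v`. -/
def siteInterval (h o : ℝ) (v : ℤ × ℤ) : Set ℝ :=
  Set.Icc (o + h * ((v.1 : ℝ) - v.2 - 1)) (o + h * ((v.1 : ℝ) - v.2 + 1))

/-- The sites `v` whose interval contains a point of the closed set with index `e (v.1 + v.2)`. -/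
def hitSites (h o : ℝ) (e : ℤ → ℤ) (F : ℤ → Closeds ℝ) : Set (ℤ × ℤ) :=
  {v | F (e (v.1 + v.2)) ∈ (missing (siteInterval h o v))ᶜ}

/-- On one antidiagonal `v.1 - v.2` has fixed parity, so distinct centres are at least `2h` apart.
-/
lemma aedisjoint_siteInterval {h : ℝ} (hh : 0 ≤ h) (o : ℝ) {v v' : ℤ × ℤ} (hne : v ≠ v')
    (hsum : v.1 + v.2 = v'.1 + v'.2) :
    AEDisjoint volume (siteInterval h o v) (siteInterval h o v') := by
  have hsub : siteInterval h o v ∩ siteInterval h o v' ⊆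
      {o + h * ((v.1 : ℝ) - v.2 + 1), o + h * ((v.1 : ℝ) - v.2 - 1)} := by
    rintro y ⟨⟨h1, h2⟩, h3, h4⟩
    have hd : v.1 - v.2 + 2 ≤ v'.1 - v'.2 ∨ v'.1 - v'.2 + 2 ≤ v.1 - v.2 := by
      by_contra hcon
      exact hne (Prod.ext (by omega) (by omega))
    rcases hd with hd | hd
    · have hd' : (v.1 : ℝ) - v.2 + 2 ≤ v'.1 - v'.2 := by exact_mod_cast hd
      left
      have := mul_le_mul_of_nonneg_left hd' hh
      linarith
    · have hd' : (v'.1 : ℝ) - v'.2 + 2 ≤ v.1 - v.2 := by exact_mod_cast hd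
      right
      have := mul_le_mul_of_nonneg_left hd' hh
      simp only [Set.mem_singleton_iff]
      linarith
  exact measure_mono_null hsub (Set.Finite.measure_zero (Set.toFinite _) _)

lemma volume_real_biUnion_siteInterval {h : ℝ} (hh : 0 ≤ h) (o : ℝ) (T : Finset (ℤ × ℤ)) (x : ℤ)
    (hT : ∀ v ∈ T, v.1 + v.2 = x) :
    volume.real (⋃ v ∈ T, siteInterval h o v) = T.card * (2 * h) := by
  rw [measureReal_def, measure_biUnion_finset₀]
  · have : ∀ v ∈ T, volume (siteInterval h o v) = ENNReal.ofReal (2 * h) := by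
      intro v _
      rw [siteInterval, Real.volume_Icc]
      congr 1
      ring
    rw [Finset.sum_congr rfl this, Finset.sum_const, nsmul_eq_mul, ENNReal.toReal_mul,
      ENNReal.toReal_ofReal (by positivity), ENNReal.toReal_natCast]
  · exact fun v hv v' hv' hne => aedisjoint_siteInterval hh o hne ((hT v hv).trans (hT v' hv').symm)
  · exact fun v _ => measurableSet_Icc.nullMeasurableSet

lemma measurableSet_mem_hitSites (h o : ℝ) (e : ℤ → ℤ) (v : ℤ × ℤ) :
    MeasurableSet {F | v ∈ hitSites h o e F} :=
  measurable_pi_apply (e (v.1 + v.2)) (measurableSet_missing isCompact_Icc).compl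

lemma measurable_hitSites (h o : ℝ) (e : ℤ → ℤ) : Measurable (hitSites h o e) :=
  measurable_set_iff.2 fun v => measurableSet_setOfPred.1 (measurableSet_mem_hitSites h o e v)

/-- Avoiding `T` means missing one compact union of intervals per fibre, and each site contributes a
factor `exp (-2hλ)`. Injectivity of `e` keeps different antidiagonals in independent fibres. -/
lemma HasPoissonVoids.map_hitSites {lam : ℝ≥0} {ν : Measure (Closeds ℝ)} [IsProbabilityMeasure ν]
    (hν : HasPoissonVoids lam ν) {h : ℝ} (hh : 0 ≤ h) (o : ℝ) {e : ℤ → ℤ}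
    (he : Function.Injective e) {p : I} (hp : 1 - (p : ℝ) = Real.exp (-(lam * (2 * h)))) :
    (Measure.infinitePi fun _ : ℤ => ν).map (hitSites h o e) = setBernoulli Set.univ p := by
  classical
  refine map_eq_setBernoulli _ _ (measurableSet_mem_hitSites h o e) p fun T => ?_
  let g : ℤ × ℤ → ℤ := fun v => e (v.1 + v.2)
  let U : ℤ → Set ℝ := fun x => ⋃ v ∈ T.filter fun v => g v = x, siteInterval h o v
  have hU : ∀ x, IsCompact (U x) := fun x =>
    Finset.isCompact_biUnion _ fun v _ => isCompact_Icc
  have hset : {F : ℤ → Closeds ℝ | ∀ v ∈ T, v ∉ hitSites h o e F} =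
      (T.image g : Set ℤ).pi fun x => missing (U x) := by
    ext F
    simp only [hitSites, Set.mem_ofPred_eq, Set.mem_compl_iff, not_not, Set.mem_pi, missing, U,
      Set.eq_empty_iff_forall_notMem, Set.mem_inter_iff, Set.mem_iUnion, Finset.mem_filter,
      Finset.mem_coe, Finset.mem_image]
    constructor
    · rintro hF _ ⟨_, _, rfl⟩ y ⟨hy, v, ⟨hv, hvx⟩, hyv⟩
      exact hF v hv y ⟨by rw [← hvx] at hy; exact hy, hyv⟩
    · rintro hF v hv y ⟨hy, hyv⟩
      exact hF (g v) ⟨v, hv, rfl⟩ y ⟨hy, v, ⟨hv, rfl⟩, hyv⟩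
  rw [hset, Measure.infinitePi_pi _ fun x _ => measurableSet_missing (hU x),
    Finset.card_eq_sum_card_image g T, ← Finset.prod_pow_eq_pow_sum]
  refine Finset.prod_congr rfl fun x hx => ?_
  obtain ⟨v₀, -, rfl⟩ := Finset.mem_image.1 hx
  rw [hν _ (hU _), volume_real_biUnion_siteInterval hh o _ (v₀.1 + v₀.2), hp,
    ← ENNReal.ofReal_pow (Real.exp_pos _).le, ← Real.exp_nat_mul]
  · congr 2
    ring
  · intro v hv
    exact he (Finset.mem_filter.1 hv).2

lemma HasPoissonVoids.measure_percolates_hitSites {lam : ℝ≥0} {ν : Measure (Closeds ℝ)}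
    [IsProbabilityMeasure ν] (hν : HasPoissonVoids lam ν) {h : ℝ} (hh : 0 ≤ h) (o : ℝ) {e : ℤ → ℤ}
    (he : Function.Injective e) {p : I} (hp : 1 - (p : ℝ) = Real.exp (-(lam * (2 * h)))) :
    Measure.infinitePi (fun _ : ℤ => ν) {F | PercolatesFromOrigin (hitSites h o e F)} =
      percolationProb p := by
  rw [percolationProb, ← hν.map_hitSites hh o he hp,
    Measure.map_apply (measurable_hitSites h o e) measurableSet_percolatesFromOrigin]
  rfl

/-- A sequence with increments bounded by `K` follows an oriented path of intervals of
length `2 K`. -/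
lemma interpolable_subset_iUnion_percolates {K : ℝ} (hK : 0 < K) :
    interpolable K ⊆ ⋃ m : ℤ, {F | PercolatesFromOrigin (hitSites K (2 * K * m) id F)} := by
  rintro F ⟨y, hy, hinc⟩
  -- This offset puts `y 0` in the interval of the origin.
  set m := ⌊(y 0 + K) / (2 * K)⌋
  have hm1 : 2 * K * m ≤ y 0 + K := by
    have := Int.floor_le ((y 0 + K) / (2 * K))
    rw [le_div_iff₀ (by positivity)] at this
    linarith
  have hm2 : y 0 + K ≤ 2 * K * m + 2 * K := by
    have := (Int.lt_floor_add_one ((y 0 + K) / (2 * K))).le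
    rw [div_le_iff₀ (by positivity)] at this
    linarith
  refine Set.mem_iUnion.2 ⟨m, ?_⟩
  set o := 2 * K * (m : ℝ)
  -- If `y n` is within `K` of the centre `c`, then `y (n + 1)` lies in `[c - 2K, c + 2K]`, which
  -- the intervals of the two successors cover, meeting at `c`. The path compares `y (n + 1)` with
  -- `c`.
  let γ : ℕ → ℤ × ℤ := fun n => Nat.rec (0, 0)
    (fun k v => v + if o + K * ((v.1 : ℝ) - v.2) ≤ y (k + 1) then (1, 0) else (0, 1)) n
  have hzero : γ 0 = (0, 0) := rfl
  have hstep : ∀ n, γ (n + 1) = γ n +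
      if o + K * (((γ n).1 : ℝ) - (γ n).2) ≤ y (n + 1) then (1, 0) else (0, 1) := fun n => rfl
  have hγ : ∀ n : ℕ, (γ n).1 + (γ n).2 = n ∧ y n ∈ siteInterval K o (γ n) := by
    intro n
    induction n with
    | zero =>
      refine ⟨rfl, ?_, ?_⟩
      · rw [hzero]
        push_cast
        linarith
      · rw [hzero]
        push_cast
        linarith
    | succ n ih =>
      obtain ⟨hsum, h1, h2⟩ := ih
      have h3 := abs_le.1 (hinc n)
      rw [hstep]
      split_ifs with hc
      · refine ⟨?_, ?_, ?_⟩ <;> push_cast [Prod.fst_add, Prod.snd_add]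
        · linarith
        · linarith
        · linarith
      · refine ⟨?_, ?_, ?_⟩ <;> push_cast [Prod.fst_add, Prod.snd_add]
        · linarith
        · linarith
        · linarith
  refine ⟨γ, rfl, fun n => ?_, fun n => ?_⟩
  · rw [hstep]
    split_ifs <;> simp
  · obtain ⟨hsum, hn⟩ := hγ n
    rw [hitSites, Set.mem_ofPred_eq, compl_missing, hsum]
    exact ⟨y n, hy n, hn⟩

/-- The hit intervals along an oriented path contain a sequence with increments bounded by three
times their half length. -/
lemma exists_sequence_of_percolates {h o : ℝ} (hh : 0 ≤ h) {e : ℤ → ℤ} {F : ℤ → Closeds ℝ}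
    (hF : PercolatesFromOrigin (hitSites h o e F)) :
    ∃ u : ℕ → ℝ, (∀ n : ℕ, u n ∈ F (e n)) ∧ (∀ n, |u (n + 1) - u n| ≤ 3 * h) ∧ |u 0 - o| ≤ h := by
  obtain ⟨ξ, hξ⟩ := (percolatesFromOrigin_iff _).1 hF
  have hu : ∀ n : ℕ, ∃ z : ℝ, z ∈ F (e n) ∧ z ∈ siteInterval h o (orientedPath ξ n) := by
    intro n
    have := hξ n
    rw [hitSites, Set.mem_ofPred_eq, compl_missing, orientedPath_add] at this
    exact this
  choose u huF huI using hu
  refine ⟨u, huF, fun n => ?_, ?_⟩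
  -- Consecutive intervals overlap in half their length, so their union has length `3h`.
  · have h1 := huI n
    have h2 := huI (n + 1)
    rw [orientedPath] at h2
    obtain ⟨h3, h4⟩ := h1
    split_ifs at h2 <;> obtain ⟨h5, h6⟩ := h2 <;>
      push_cast [Prod.fst_add, Prod.snd_add] at h5 h6 <;> rw [abs_le] <;> constructor <;> linarith
  · obtain ⟨h1, h2⟩ := huI 0
    simp only [orientedPath] at h1 h2
    push_cast at h1 h2
    rw [abs_le]
    constructor <;> linarith

/-- The `n`-th site of an oriented path reads only fibre `e n`. This locality gives the independence
of the forward and backward half-lines. -/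
lemma measurableSet_percolates_hitSites (h o : ℝ) (e : ℤ → ℤ) (S : Set ℤ)
    (he : ∀ n : ℕ, e n ∈ S) :
    MeasurableSet[⨆ x ∈ S, MeasurableSpace.comap (fun F : ℤ → Closeds ℝ => F x) fellBorel]
      {F | PercolatesFromOrigin (hitSites h o e F)} := by
  simp_rw [percolatesFromOrigin_iff]
  refine @measurableSet_exists_branch _
    (⨆ x ∈ S, MeasurableSpace.comap (fun F : ℤ → Closeds ℝ => F x) fellBorel)
    (fun n ξ => {F | orientedPath ξ n ∈ hitSites h o e F})
    (fun n ξ τ h => by simp only [orientedPath_congr n h]) fun n ξ => ?_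
  have hle : MeasurableSpace.comap (fun F : ℤ → Closeds ℝ => F (e n)) fellBorel ≤
      ⨆ x ∈ S, MeasurableSpace.comap (fun F : ℤ → Closeds ℝ => F x) fellBorel :=
    le_iSup₂_of_le (e n) (he n) le_rfl
  refine hle _ ⟨(missing (siteInterval h o (orientedPath ξ n)))ᶜ,
    (measurableSet_missing isCompact_Icc).compl, ?_⟩
  ext F
  simp only [hitSites, orientedPath_add, Set.mem_preimage, Set.mem_ofPred_eq]

lemma HasPoissonVoids.interpolable_eq_zero {lam K : ℝ≥0} {ν : Measure (Closeds ℝ)}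
    [IsProbabilityMeasure ν] (hν : HasPoissonVoids lam ν) (hK : 0 < K)
    (hlt : 1 - Real.exp (-(lam * (2 * K))) < orientedThreshold) :
    Measure.infinitePi (fun _ : ℤ => ν) (interpolable K) = 0 := by
  have hexp : Real.exp (-(lam * (2 * K) : ℝ)) ≤ 1 := by
    rw [Real.exp_le_one_iff, neg_nonpos]
    positivity
  let p : I := ⟨1 - Real.exp (-(lam * (2 * K))), by linarith,
    by linarith [Real.exp_pos (-(lam * (2 * K) : ℝ))]⟩
  refine measure_mono_null (interpolable_subset_iUnion_percolates (NNReal.coe_pos.2 hK))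
    (measure_iUnion_null fun m => ?_)
  rw [hν.measure_percolates_hitSites K.coe_nonneg _ Function.injective_id (p := p) (by simp [p])]
  exact percolationProb_eq_zero_of_lt hlt

lemma HasPoissonVoids.interpolable_eq_one {lam K : ℝ≥0} {ν : Measure (Closeds ℝ)}
    [IsProbabilityMeasure ν] (hν : HasPoissonVoids lam ν)
    (hlt : orientedThreshold < 1 - Real.exp (-(lam * (2 * (K / 3))))) :
    Measure.infinitePi (fun _ : ℤ => ν) (interpolable K) = 1 := by
  refine (interpolable_eq_zero_or_one ν K.coe_nonneg).resolve_left (ne_of_gt ?_)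
  set μ := Measure.infinitePi fun _ : ℤ => ν
  set h : ℝ := K / 3
  have hh : 0 ≤ h := by positivity
  have hexp : Real.exp (-(lam * (2 * h) : ℝ)) ≤ 1 := by
    rw [Real.exp_le_one_iff, neg_nonpos]
    positivity
  let p : I := ⟨1 - Real.exp (-(lam * (2 * h))), by linarith,
    by linarith [Real.exp_pos (-(lam * (2 * h) : ℝ))]⟩
  have hp : 0 < percolationProb p := percolationProb_pos_of_lt hlt
  set A : Set (ℤ → Closeds ℝ) := {F | PercolatesFromOrigin (hitSites h 0 id F)}
  -- The backward path uses fibres `-1, -2, …`. It starts in `[-2h, 0]` and the forward one in `[-h,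
  -- h]`, so the joining increment is at most `3h = K`.
  set B : Set (ℤ → Closeds ℝ) := {F | PercolatesFromOrigin (hitSites h (-h) (fun x => -1 - x) F)}
  have hA : μ A = percolationProb p :=
    hν.measure_percolates_hitSites hh _ Function.injective_id (by simp [p])
  have hB : μ B = percolationProb p :=
    hν.measure_percolates_hitSites hh _ (fun x y hxy => by simpa using hxy) (by simp [p])
  have hind : iIndepFun (fun (x : ℤ) (F : ℤ → Closeds ℝ) => F x) μ :=
    iIndepFun_infinitePi (X := fun _ => id) fun _ => measurable_id
  have hAB : μ (A ∩ B) = μ A * μ B := by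
    have := indep_iSup_of_disjoint (fun x => (measurable_pi_apply x).comap_le) hind
      (S := Set.Ici 0) (T := Set.Iio 0) (Set.disjoint_left.2 fun x hx hx' =>
        (Set.mem_Iio.1 hx').not_ge (Set.mem_Ici.1 hx))
    refine (Indep_iff _ _ _).1 this A B (measurableSet_percolates_hitSites _ _ _ _ fun n => ?_)
      (measurableSet_percolates_hitSites _ _ _ _ fun n => ?_)
    · simp
    · simp only [Set.mem_Iio]
      omega
  refine lt_of_lt_of_le ?_ (measure_mono (?_ : A ∩ B ⊆ interpolable K))
  · rw [hAB, hA, hB]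
    exact ENNReal.mul_pos hp.ne' hp.ne'
  rintro F ⟨hFA, hFB⟩
  obtain ⟨u, huF, hu, hu0⟩ := exists_sequence_of_percolates hh hFA
  obtain ⟨w, hwF, hw, hw0⟩ := exists_sequence_of_percolates hh hFB
  have h3 : 3 * h = K := by simp only [h]; ring
  refine ⟨fun x => if 0 ≤ x then u x.toNat else w (-1 - x).toNat, fun x => ?_, fun x => ?_⟩
  · beta_reduce
    split_ifs with hx
    · have := huF x.toNat
      rwa [Int.toNat_of_nonneg hx] at this
    · have := hwF (-1 - x).toNat
      rwa [Int.toNat_of_nonneg (by omega), sub_sub_cancel] at this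
  · rw [← h3]
    beta_reduce
    rcases lt_trichotomy x (-1) with hx | rfl | hx
    · rw [if_neg (by omega), if_neg (by omega), abs_sub_comm]
      convert hw (-1 - (x + 1)).toNat using 4
      omega
    · rw [if_pos (by omega), if_neg (by omega)]
      simp only [neg_add_cancel, Int.toNat_zero, sub_self]
      have h1 := abs_le.1 hu0
      have h2 := abs_le.1 hw0
      rw [abs_le]
      constructor <;> linarith
    · rw [if_pos (by omega), if_pos (by omega)]
      convert hu x.toNat using 4
      omega

end Comparison

/-! ### Poisson point processes -/

section Poisson

attribute [local instance] fellBorel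

variable {Ω : Type*} [MeasurableSpace Ω]

lemma IsPoissonPointProcess.hasPoissonVoids {lam : ℝ≥0} {Y : Ω → Closeds ℝ} {P : Measure Ω}
    (h : IsPoissonPointProcess lam Y P) : HasPoissonVoids lam (P.map Y) := by
  intro C hC
  have hlaw := h.hasLaw_count C hC.measurableSet hC.isBounded
  rw [Measure.map_apply h.isRandomClosedSet (measurableSet_missing hC)]
  have hset : Y ⁻¹' missing C = (fun ω => ((Y ω : Set ℝ) ∩ C).encard) ⁻¹' {0} := by
    ext ω
    simp [missing]
  have hpre : (fun n : ℕ => (n : ℕ∞)) ⁻¹' {0} = {0} := by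
    ext n
    simp
  rw [hset, ← Measure.map_apply_of_aemeasurable hlaw.aemeasurable (measurableSet_singleton _),
    hlaw.map_eq, Measure.map_apply (by fun_prop) (measurableSet_singleton _), hpre,
    poissonMeasure_singleton]
  simp [measureReal_def, ENNReal.coe_toNNReal_eq_toReal]

lemma IsIndepPoissonFamily.map_eq_infinitePi {lam : ℝ≥0} {Y : ℤ → Ω → Closeds ℝ} {P : Measure Ω}
    [IsProbabilityMeasure P] (h : IsIndepPoissonFamily lam Y P) :
    P.map (fun ω x => Y x ω) = Measure.infinitePi fun _ : ℤ => P.map (Y 0) := by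
  have hm : ∀ x, Measurable (Y x) := fun x => (h.poisson x).isRandomClosedSet
  rw [(iIndepFun_iff_map_fun_eq_infinitePi_map hm).1 h.indep]
  have hprob : ∀ x, IsProbabilityMeasure (P.map (Y x)) := fun x =>
    Measure.isProbabilityMeasure_map (hm x).aemeasurable
  congr 1
  funext x
  exact (h.poisson x).hasPoissonVoids.unique (h.poisson 0).hasPoissonVoids

end Poisson

/-! ### The critical value -/

section Critical

attribute [local instance] fellBorel

/-- The products of intensity and Lipschitz constant for which interpolation is almost surely
possible. -/
def interpolationRange : Set ℝ :=
  {t | ∃ (lam K : ℝ≥0) (ν : Measure (Closeds ℝ)), 0 < lam ∧ 0 < K ∧ IsProbabilityMeasure ν ∧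
    HasPoissonVoids lam ν ∧ t = lam * K ∧
    Measure.infinitePi (fun _ : ℤ => ν) (interpolable K) = 1}

/-- The critical value of the product of intensity and Lipschitz constant. -/
noncomputable def criticalProduct : ℝ :=
  -- The inserted point makes the set nonempty and the upper bound immediate, without constructing a
  -- Poisson process.
  sInf (insert (-(3 / 2) * Real.log (1 - orientedThreshold)) interpolationRange)

lemma le_of_mem_interpolationRange {t : ℝ} (ht : t ∈ interpolationRange) :
    -(1 / 2) * Real.log (1 - orientedThreshold) ≤ t := by
  obtain ⟨lam, K, ν, -, hK, _, hν, rfl, h1⟩ := ht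
  by_contra hlt
  have hpos : 0 < 1 - orientedThreshold := by linarith [orientedThreshold_lt_one]
  have h0 := hν.interpolable_eq_zero hK (by
    have : 1 - orientedThreshold < Real.exp (-(lam * (2 * K) : ℝ)) := by
      rw [← Real.log_lt_iff_lt_exp hpos]
      linarith
    linarith)
  rw [h0] at h1
  exact zero_ne_one h1

lemma log_one_sub_orientedThreshold_nonpos : Real.log (1 - orientedThreshold) ≤ 0 :=
  Real.log_nonpos (by linarith [orientedThreshold_lt_one]) (by linarith [orientedThreshold_nonneg])

lemma mem_lowerBounds_insert_interpolationRange :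
    -(1 / 2) * Real.log (1 - orientedThreshold) ∈ lowerBounds
      (insert (-(3 / 2) * Real.log (1 - orientedThreshold)) interpolationRange) := by
  rintro t (rfl | ht)
  · linarith [log_one_sub_orientedThreshold_nonpos]
  · exact le_of_mem_interpolationRange ht

lemma criticalProduct_mem_Icc : criticalProduct ∈ Set.Icc
    (-(1 / 2) * Real.log (1 - orientedThreshold)) (-(3 / 2) * Real.log (1 - orientedThreshold)) :=
  ⟨le_csInf (Set.insert_nonempty _ _) mem_lowerBounds_insert_interpolationRange,
    csInf_le ⟨_, mem_lowerBounds_insert_interpolationRange⟩ (Set.mem_insert _ _)⟩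

lemma HasPoissonVoids.interpolable_eq_zero_of_lt_criticalProduct {lam K : ℝ≥0}
    {ν : Measure (Closeds ℝ)} [hprob : IsProbabilityMeasure ν] (hν : HasPoissonVoids lam ν)
    (hlam : 0 < lam) (hK : 0 < K) (hlt : (lam * K : ℝ) < criticalProduct) :
    Measure.infinitePi (fun _ : ℤ => ν) (interpolable K) = 0 := by
  refine (interpolable_eq_zero_or_one ν K.coe_nonneg).resolve_right fun h1 => ?_
  refine hlt.not_ge (csInf_le ⟨_, mem_lowerBounds_insert_interpolationRange⟩ (.inr ?_))
  exact ⟨lam, K, ν, hlam, hK, hprob, hν, rfl, h1⟩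

/-- Some element of the set lies below the given product: the inserted point, where percolation
applies directly, or a product with probability one, from which monotonicity carries over. -/
lemma HasPoissonVoids.interpolable_eq_one_of_criticalProduct_lt {lam K : ℝ≥0}
    {ν : Measure (Closeds ℝ)} [IsProbabilityMeasure ν] (hν : HasPoissonVoids lam ν)
    (hlam : 0 < lam) (hlt : criticalProduct < lam * K) :
    Measure.infinitePi (fun _ : ℤ => ν) (interpolable K) = 1 := by
  obtain ⟨t, ht, htlt⟩ := exists_lt_of_csInf_lt (Set.insert_nonempty _ _) hlt
  rcases ht with rfl | ⟨lam', K', ν', hlam', -, _, hν', rfl, h1⟩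
  · refine hν.interpolable_eq_one ?_
    have hpos : 0 < 1 - orientedThreshold := by linarith [orientedThreshold_lt_one]
    have : Real.exp (-(lam * (2 * (K / 3)) : ℝ)) < 1 - orientedThreshold := by
      rw [← Real.lt_log_iff_exp_lt hpos]
      linarith
    linarith
  · refine le_antisymm prob_le_one (h1.symm.le.trans ?_)
    exact hν'.interpolable_le hν hlam' hlam (by exact_mod_cast htlt.le)

end Critical

end InterpolationPercolation

open InterpolationPercolation
theorem theorem5 :
    orientedThreshold < 1 ∧
    ∃ lamc : ℝ,
      lamc ∈ Set.Icc (-(1 / 2) * Real.log (1 - orientedThreshold))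
        (-(3 / 2) * Real.log (1 - orientedThreshold)) ∧
      ∀ (Ω : Type*) [MeasurableSpace Ω] (P : Measure Ω) [IsProbabilityMeasure P]
        (lam K : ℝ≥0) (Y : ℤ → Ω → Closeds ℝ),
        0 < lam → 0 < K → IsIndepPoissonFamily lam Y P →
          NullMeasurableSet (lipschitzEvent Y K) P ∧
          ((lam : ℝ) < lamc / K → P (lipschitzEvent Y K) = 0) ∧
          (lamc / K < (lam : ℝ) → P (lipschitzEvent Y K) = 1) := by
  refine ⟨orientedThreshold_lt_one, criticalProduct, criticalProduct_mem_Icc, ?_⟩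
  intro Ω _ P _ lam K Y hlam hK hY
  let _ := fellBorel
  have hm : Measurable fun ω x => Y x ω :=
    measurable_pi_lambda _ fun x => (hY.poisson x).isRandomClosedSet
  have hset : lipschitzEvent Y K = (fun ω x => Y x ω) ⁻¹' interpolable K := by
    ext ω
    exact mem_interpolable_iff_exists_lipschitzWith.symm
  have hI : MeasurableSet (interpolable K) := measurableSet_interpolable K.coe_nonneg
  have hν := (hY.poisson 0).hasPoissonVoids
  have := Measure.isProbabilityMeasure_map (μ := P)
    (hY.poisson 0).isRandomClosedSet.aemeasurable
  have hK' : (0 : ℝ) < K := hK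
  have hP : P (lipschitzEvent Y K) =
      Measure.infinitePi (fun _ : ℤ => P.map (Y 0)) (interpolable K) := by
    rw [hset, ← Measure.map_apply hm hI, hY.map_eq_infinitePi]
  refine ⟨hset ▸ (hm hI).nullMeasurableSet, fun hlt => ?_, fun hlt => ?_⟩
  · rw [hP]
    exact hν.interpolable_eq_zero_of_lt_criticalProduct hlam hK ((lt_div_iff₀ hK').1 hlt)
  · rw [hP]
    exact hν.interpolable_eq_one_of_criticalProduct_lt hlam ((div_lt_iff₀ hK').1 hlt)
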